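/- For a triangle in the Euclidean plane, let $a,b,c$ denote its side lengths, $p=(a+b+c)/2$ its semi-perimeter, $R$ its circumradius and $r$ its inradius. Let $$\begin{aligned}p_2(t)={}&91750400t^{20}-857210880t^{19}+3560046592t^{18}-8616673280t^{17}+13364330496t^{16}-13704527872t^{15}+9174425600t^{14}-3719282688t^{13}+689182720t^{12}+53528576t^{11}-36429312t^{10}+533760t^{9}+207104t^{8}+75520t^{7}+32352t^{6}+11376t^{5}-320t^{4}-104t^{3}-30t^{2}-7t-1\end{aligned}$$ and $$\begin{aligned}p_4(k)={}&582076609134674072265625k^{40}-347825698554515838623046875k^{38}+100074581801891326904296875000k^{36}\\&-18656729921698570251464843750000k^{34}+2406402165103435516357421875000000k^{32}-223881811253170562744140625000000000k^{30}\\&+13463175828870323610839843750000000000k^{28}-546554928845186341347265625000000000000k^{26}+44602844570033253018161875000000000000000k^{24}\\&-5130242398470886015317438950000000000000000k^{22}+805214383330095009369880969748800000000000000k^{20}+8091804003905867976154901735852032000000000000k^{18}\\&-262076670696960781271382283372767764480000000000k^{16}+483089080872113925346827615868453187944448000000000k^{14}+76133654804831682593043073614469922630706135040000000k^{12}\\&+4656778296665388277933286028092539858012767959121920000k^{10}+144475786697302680271016689740018636544036558347226316800k^{8}+2305862812061518538327375046497265994061106944720616030208k^{6}\\&+14131109130840787698067340120866948829204788093469111353344k^{4}-27802797644590317388762803455393575731200000000000000000000k^{2}+9774552621457470122500000000000000000000000000000000000000.\end{aligned}$$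 The polynomial $p_4$ has exactly one root $k_0\approx 0.6898369707$ in the interval $\left(\frac12,\frac9{13}\right)$, and the polynomial $p_2$ has exactly one root $t_1\approx 0.5194285605$ in the interval $\left(\frac12,\frac35\right)$ (both approximations correct to ten decimals). If $k\le k_0$, then for every triangle $$p\ \ge\ 3\sqrt3\,r+k\left[1-\left(\frac{2r}{R}\right)^5\right]r .$$ The constant $k_0$ is best possible: for every $k>k_0$ the inequality fails for some triangle. For $k\le k_0$, equality holds if and only if either the triangle is equilateral, or $k=k_0$ and, with a suitable labelling of the sides, $a:b:c=2t_1:1:1$. -/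

import Mathlib

/-- The semi-perimeter `p` of a triangle in the Euclidean plane. -/
noncomputable def semiperimeter (T : Affine.Triangle ℝ (EuclideanSpace ℝ (Fin 2))) : ℝ :=
  (dist (T.points 0) (T.points 1) + dist (T.points 1) (T.points 2) +
    dist (T.points 2) (T.points 0)) / 2

/-- The right-hand side `3√3 r + k [1 - (2r/R)^5] r`, where `R` is the circumradius and `r` is the
inradius of the triangle. -/
noncomputable def lowerBound (k : ℝ) (T : Affine.Triangle ℝ (EuclideanSpace ℝ (Fin 2))) : ℝ :=
  3 * √3 * T.inradius + k * (1 - (2 * T.inradius / T.circumradius) ^ 5) * T.inradius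

/-- The side lengths `a, b, c` of the triangle, labelled in a suitable order, satisfy
`a : b : c = x : 1 : 1`. -/
def SideRatio (x : ℝ) (T : Affine.Triangle ℝ (EuclideanSpace ℝ (Fin 2))) : Prop :=
  ∃ σ : Equiv.Perm (Fin 3),
    dist (T.points (σ 1)) (T.points (σ 2)) = x * dist (T.points (σ 0)) (T.points (σ 1)) ∧
    dist (T.points (σ 2)) (T.points (σ 0)) = dist (T.points (σ 0)) (T.points (σ 1))

/-- The polynomial `p₂`, of degree 20. -/
noncomputable def p₂ (t : ℝ) : ℝ :=
  91750400 * t ^ 20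
    - 857210880 * t ^ 19
    + 3560046592 * t ^ 18
    - 8616673280 * t ^ 17
    + 13364330496 * t ^ 16
    - 13704527872 * t ^ 15
    + 9174425600 * t ^ 14
    - 3719282688 * t ^ 13
    + 689182720 * t ^ 12
    + 53528576 * t ^ 11
    - 36429312 * t ^ 10
    + 533760 * t ^ 9
    + 207104 * t ^ 8
    + 75520 * t ^ 7
    + 32352 * t ^ 6
    + 11376 * t ^ 5
    - 320 * t ^ 4
    - 104 * t ^ 3
    - 30 * t ^ 2
    - 7 * t
    - 1

/-- The polynomial `p₄`, of degree 40. -/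
noncomputable def p₄ (k : ℝ) : ℝ :=
  582076609134674072265625 * k ^ 40
    - 347825698554515838623046875 * k ^ 38
    + 100074581801891326904296875000 * k ^ 36
    - 18656729921698570251464843750000 * k ^ 34
    + 2406402165103435516357421875000000 * k ^ 32
    - 223881811253170562744140625000000000 * k ^ 30
    + 13463175828870323610839843750000000000 * k ^ 28
    - 546554928845186341347265625000000000000 * k ^ 26
    + 44602844570033253018161875000000000000000 * k ^ 24
    - 5130242398470886015317438950000000000000000 * k ^ 22
    + 805214383330095009369880969748800000000000000 * k ^ 20
    + 8091804003905867976154901735852032000000000000 * k ^ 18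
    - 262076670696960781271382283372767764480000000000 * k ^ 16
    + 483089080872113925346827615868453187944448000000000 * k ^ 14
    + 76133654804831682593043073614469922630706135040000000 * k ^ 12
    + 4656778296665388277933286028092539858012767959121920000 * k ^ 10
    + 144475786697302680271016689740018636544036558347226316800 * k ^ 8
    + 2305862812061518538327375046497265994061106944720616030208 * k ^ 6
    + 14131109130840787698067340120866948829204788093469111353344 * k ^ 4
    - 27802797644590317388762803455393575731200000000000000000000 * k ^ 2
    + 9774552621457470122500000000000000000000000000000000000000

/-! Put q = 2r/R. Euler's inequality gives 0 < q ≤ 1, so q = 4t(1-t) with a unique t in [1/2, 1).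
Among triangles with this q, the ratio p/r is smallest exactly for the shape 2t : 1 : 1
(`exists_isosceles_le`). In tangent lengths this is one polynomial identity, `isosceles_comparison`,
whose right side is a square times factors of known sign. The claim thus becomes nonnegativity of
`isoscelesExcess k` on [1/2, 1).

The excess vanishes at t = 1/2, the equilateral case. For k > 0 and t > 1/2 its derivative has the
sign of 1 - k² `critical t`, and `critical` rises up to `criticalMax` and falls afterwards. At the
extremal k the excess therefore increases, decreases and increases again, with a second zero exactly
at its interior local minimum t₁ (`IsExtremal.isoscelesExcess_pos`). Other values of k reduce to k₀
because the excess is affine and nonincreasing in k.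

The pair (k₀, t₁) is determined by the vanishing of the excess and of its derivative. The derivative
gives k₀² = (1 + t₁) / (5120² t₁¹² (1 - t₁)¹¹). Substituting this in the squared equation for the
excess leaves (2t - 1)³ p₂(t) = 0. That k₀ is a root of p₄ is checked by exact arithmetic modulo p₂
(`p₄_eq_zero`). The roots are unique because a Möbius substitution sending the interval to (0, ∞)
leaves a single sign change among the coefficients. -/

/-! ### Polynomials as coefficient lists -/

/-- Evaluation of an integer polynomial given by the list of its coefficients, constant term
first. -/
def coeffEval (l : List ℤ) (x : ℝ) : ℝ := l.foldr (fun c s ↦ c + x * s) 0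

@[simp] theorem coeffEval_nil (x : ℝ) : coeffEval [] x = 0 := rfl

@[simp] theorem coeffEval_cons (c : ℤ) (l : List ℤ) (x : ℝ) :
    coeffEval (c :: l) x = c + x * coeffEval l x := rfl

theorem coeffEval_append (l m : List ℤ) (x : ℝ) :
    coeffEval (l ++ m) x = coeffEval l x + x ^ l.length * coeffEval m x := by
  induction l with
  | nil => simp
  | cons c l ih => simp [ih, pow_succ]; ring

theorem coeffEval_map_mul (a : ℤ) (l : List ℤ) (x : ℝ) :
    coeffEval (l.map (a * ·)) x = a * coeffEval l x := by
  induction l with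
  | nil => simp
  | cons c l ih => simp [ih]; ring

/-- Sum of coefficient lists. -/
def coeffAdd : List ℤ → List ℤ → List ℤ
  | [], m => m
  | l, [] => l
  | a :: l, b :: m => (a + b) :: coeffAdd l m

theorem coeffEval_coeffAdd (l m : List ℤ) (x : ℝ) :
    coeffEval (coeffAdd l m) x = coeffEval l x + coeffEval m x := by
  fun_induction coeffAdd l m with
  | case1 => simp
  | case2 => simp
  | case3 a l b m ih => simp [ih]; ring

/-- Product of coefficient lists. -/
def coeffMul : List ℤ → List ℤ → List ℤ
  | [], _ => []
  | a :: l, m => coeffAdd (m.map (a * ·)) (0 :: coeffMul l m)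

theorem coeffEval_coeffMul (l m : List ℤ) (x : ℝ) :
    coeffEval (coeffMul l m) x = coeffEval l x * coeffEval m x := by
  induction l with
  | nil => simp [coeffMul]
  | cons a l ih => simp [coeffMul, coeffEval_coeffAdd, coeffEval_map_mul, ih]; ring

/-- Powers of a coefficient list. -/
def coeffPow (l : List ℤ) : ℕ → List ℤ
  | 0 => [1]
  | n + 1 => coeffMul l (coeffPow l n)

theorem coeffEval_coeffPow (l : List ℤ) (n : ℕ) (x : ℝ) :
    coeffEval (coeffPow l n) x = coeffEval l x ^ n := by
  induction n with
  | zero => simp [coeffPow]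
  | succ n ih => simp [coeffPow, coeffEval_coeffMul, ih, pow_succ']

/-- The coefficients of `g ^ l.length * l (f / g)`. -/
def coeffHom (f g : List ℤ) : List ℤ → List ℤ
  | [] => []
  | c :: l => coeffAdd ((coeffPow g (l.length + 1)).map (c * ·)) (coeffMul f (coeffHom f g l))

/-- The exponent `l.length` is one more than the formal degree of `l`. The surplus factor g adds no
zeros where g is nonzero. -/
theorem coeffEval_coeffHom {f g : List ℤ} {x : ℝ} (hg : coeffEval g x ≠ 0) (l : List ℤ) :
    coeffEval (coeffHom f g l) x =
      coeffEval g x ^ l.length * coeffEval l (coeffEval f x / coeffEval g x) := by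
  induction l with
  | nil => simp [coeffHom]
  | cons c l ih =>
    simp only [coeffHom, coeffEval_coeffAdd, coeffEval_map_mul, coeffEval_coeffPow,
      coeffEval_coeffMul, ih, coeffEval_cons, List.length_cons]
    field_simp
    ring

/-! ### A polynomial with one sign change has at most one positive root -/

theorem coeffEval_neg {l : List ℤ} (hl : ∀ c ∈ l, c < 0) (hne : l ≠ []) {x : ℝ} (hx : 0 ≤ x) :
    coeffEval l x < 0 := by
  induction l with
  | nil => exact absurd rfl hne
  | cons c l ih =>
    have hc : (c : ℝ) < 0 := by exact_mod_cast hl c (by simp)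
    rcases eq_or_ne l [] with rfl | h
    · simpa using hc
    · have := ih (fun d hd ↦ hl d (by simp [hd])) h
      rw [coeffEval_cons]; nlinarith

theorem coeffEval_anti {l : List ℤ} (hl : ∀ c ∈ l, c < 0) {x y : ℝ} (hx : 0 ≤ x) (hxy : x ≤ y) :
    coeffEval l y ≤ coeffEval l x := by
  induction l with
  | nil => simp
  | cons c l ih =>
    have h := ih fun d hd ↦ hl d (by simp [hd])
    have hle : coeffEval l y ≤ 0 := by
      rcases eq_or_ne l [] with rfl | hne
      · simp
      · exact (coeffEval_neg (fun d hd ↦ hl d (by simp [hd])) hne (hx.trans hxy)).le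
    rw [coeffEval_cons, coeffEval_cons]; nlinarith

/-- Division-free form of the fact that l(x) / x^n is nonincreasing when the degree is at most n. -/
theorem coeffEval_mul_pow_le {l : List ℤ} (hl : ∀ c ∈ l, 0 ≤ c) {n : ℕ} (hn : l.length ≤ n + 1)
    {x y : ℝ} (hx : 0 ≤ x) (hxy : x ≤ y) :
    coeffEval l y * x ^ n ≤ coeffEval l x * y ^ n := by
  induction l generalizing n with
  | nil => simp
  | cons c l ih =>
    have hc : (0 : ℝ) ≤ c := by exact_mod_cast hl c (by simp)
    have hp : x ^ n ≤ y ^ n := pow_le_pow_left₀ hx hxy n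
    rw [coeffEval_cons, coeffEval_cons]
    rcases n with _ | n
    · have : l = [] := by simpa using hn
      simp [this]
    · have h := ih (fun d hd ↦ hl d (by simp [hd])) (n := n) (by simpa using hn)
      have hy := hx.trans hxy
      have h1 := mul_le_mul_of_nonneg_left h (mul_nonneg hx hy)
      have h2 := mul_le_mul_of_nonneg_left hp hc
      calc _ = c * x ^ (n + 1) + x * y * (coeffEval l y * x ^ n) := by ring
        _ ≤ c * y ^ (n + 1) + x * y * (coeffEval l x * y ^ n) := add_le_add h2 h1
        _ = _ := by ring

/-- Write the polynomial as A + x^(n+1) B with A the nonnegative part. On x > 0 the quotient by x^n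
is A / x^n + x B, where the first term is nonincreasing and the second strictly decreasing, so two
zeros are impossible. -/
theorem coeffEval_ne_of_one_sign_change {l : List ℤ} {n : ℕ} (hpos : ∀ c ∈ l.take (n + 1), 0 ≤ c)
    (hneg : ∀ c ∈ l.drop (n + 1), c < 0) (hlen : n + 1 < l.length) {x y : ℝ} (hx : 0 < x)
    (hxy : x < y) (hlx : coeffEval l x = 0) : coeffEval l y ≠ 0 := by
  intro hly
  have hy := hx.trans hxy
  rw [← List.take_append_drop (n + 1) l, coeffEval_append, List.length_take,
    min_eq_left hlen.le] at hlx hly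
  have hne : l.drop (n + 1) ≠ [] := by simpa using hlen
  have h1 := coeffEval_mul_pow_le hpos (n := n) (by simp) hx.le hxy.le
  have h2 := coeffEval_anti hneg hx.le hxy.le
  have h3 := coeffEval_neg hneg hne hx.le
  rw [eq_neg_of_add_eq_zero_left hlx, eq_neg_of_add_eq_zero_left hly] at h1
  have h4 : x ^ n * y ^ n * (x * coeffEval (l.drop (n + 1)) x) ≤
      x ^ n * y ^ n * (y * coeffEval (l.drop (n + 1)) y) := by
    calc _ = - (-(x ^ (n + 1) * coeffEval (l.drop (n + 1)) x) * y ^ n) := by ring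
      _ ≤ - (-(y ^ (n + 1) * coeffEval (l.drop (n + 1)) y) * x ^ n) := neg_le_neg h1
      _ = _ := by ring
  have h5 := le_of_mul_le_mul_left h4 (by positivity)
  nlinarith

/-- Uniqueness of the root in the image of the positive half-line under a Möbius transformation,
by Descartes' rule of signs. -/
theorem coeffEval_root_unique {l f g : List ℤ} {n : ℕ}
    (hpos : ∀ c ∈ (coeffHom f g l).take (n + 1), 0 ≤ c)
    (hneg : ∀ c ∈ (coeffHom f g l).drop (n + 1), c < 0) (hlen : n + 1 < (coeffHom f g l).length)
    {u v x y : ℝ} (hu : 0 < u) (hv : 0 < v) (hgu : coeffEval g u ≠ 0) (hgv : coeffEval g v ≠ 0)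
    (hxu : x = coeffEval f u / coeffEval g u) (hyv : y = coeffEval f v / coeffEval g v)
    (hx : coeffEval l x = 0) (hy : coeffEval l y = 0) : x = y := by
  have h1 : coeffEval (coeffHom f g l) u = 0 := by rw [coeffEval_coeffHom hgu, ← hxu, hx, mul_zero]
  have h2 : coeffEval (coeffHom f g l) v = 0 := by rw [coeffEval_coeffHom hgv, ← hyv, hy, mul_zero]
  rcases lt_trichotomy u v with h | h | h
  · exact absurd h2 (coeffEval_ne_of_one_sign_change hpos hneg hlen hu h h1)
  · rw [hxu, hyv, h]
  · exact absurd h1 (coeffEval_ne_of_one_sign_change hpos hneg hlen hv h h2)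

/-! ### The roots of `p₂` and `p₄` -/

/-- The coefficients of `p₂`. -/
def coeffP₂ : List ℤ :=
  [-1, -7, -30, -104, -320, 11376, 32352, 75520, 207104, 533760, -36429312, 53528576, 689182720,
    -3719282688, 9174425600, -13704527872, 13364330496, -8616673280, 3560046592, -857210880,
    91750400]

/-- The coefficients of `p₄` as a polynomial in `k ^ 2`. -/
def coeffP₄ : List ℤ :=
  [9774552621457470122500000000000000000000000000000000000000,
    -27802797644590317388762803455393575731200000000000000000000,
    14131109130840787698067340120866948829204788093469111353344,
    2305862812061518538327375046497265994061106944720616030208,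
    144475786697302680271016689740018636544036558347226316800,
    4656778296665388277933286028092539858012767959121920000,
    76133654804831682593043073614469922630706135040000000,
    483089080872113925346827615868453187944448000000000,
    -262076670696960781271382283372767764480000000000,
    8091804003905867976154901735852032000000000000, 805214383330095009369880969748800000000000000,
    -5130242398470886015317438950000000000000000, 44602844570033253018161875000000000000000,
    -546554928845186341347265625000000000000, 13463175828870323610839843750000000000,
    -223881811253170562744140625000000000, 2406402165103435516357421875000000,
    -18656729921698570251464843750000, 100074581801891326904296875000,
    -347825698554515838623046875, 582076609134674072265625]

theorem p₂_eq_coeffEval (t : ℝ) : p₂ t = coeffEval coeffP₂ t := by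
  simp only [p₂, coeffP₂, coeffEval_cons, coeffEval_nil]
  push_cast
  ring

theorem p₄_eq_coeffEval (k : ℝ) : p₄ k = coeffEval coeffP₄ (k ^ 2) := by
  simp only [p₄, coeffP₄, coeffEval_cons, coeffEval_nil]
  push_cast
  ring

theorem p₂_root_unique {x y : ℝ} (hx : x ∈ Set.Ioo (1 / 2 : ℝ) (3 / 5))
    (hy : y ∈ Set.Ioo (1 / 2 : ℝ) (3 / 5)) (hpx : p₂ x = 0) (hpy : p₂ y = 0) : x = y := by
  -- The substitution z = (5 + 6u) / (10 + 10u) carries u in (0, ∞) onto (1/2, 3/5); the fraction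
  -- here is its inverse.
  have key : ∀ z ∈ Set.Ioo (1 / 2 : ℝ) (3 / 5), 0 < (10 * z - 5) / (6 - 10 * z) ∧
      coeffEval [10, 10] ((10 * z - 5) / (6 - 10 * z)) ≠ 0 ∧
      z = coeffEval [5, 6] ((10 * z - 5) / (6 - 10 * z)) /
        coeffEval [10, 10] ((10 * z - 5) / (6 - 10 * z)) := by
    rintro z ⟨h1, h2⟩
    have h3 : 0 < 6 - 10 * z := by linarith
    have h4 : 0 < (10 * z - 5) / (6 - 10 * z) := div_pos (by linarith) h3
    refine ⟨h4, ?_, ?_⟩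
    · simp only [coeffEval_cons, coeffEval_nil]; push_cast; positivity
    · have h5 : 10 + (10 * z - 5) / (6 - 10 * z) * 10 ≠ 0 := by positivity
      simp only [coeffEval_cons, coeffEval_nil]
      push_cast
      simp only [mul_zero, add_zero]
      rw [eq_div_iff h5]
      linear_combination -div_mul_cancel₀ (10 * z - 5) h3.ne'
  obtain ⟨hu, hgu, hxu⟩ := key x hx
  obtain ⟨hv, hgv, hyv⟩ := key y hy
  rw [p₂_eq_coeffEval] at hpx hpy
  exact coeffEval_root_unique (n := 4) (by decide +kernel) (by decide +kernel) (by decide +kernel)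
    hu hv hgu hgv hxu hyv hpx hpy

theorem p₄_root_unique {x y : ℝ} (hx : x ∈ Set.Ioo (1 / 2 : ℝ) (9 / 13))
    (hy : y ∈ Set.Ioo (1 / 2 : ℝ) (9 / 13)) (hpx : p₄ x = 0) (hpy : p₄ y = 0) : x = y := by
  -- The polynomial is treated in the variable z², which runs over (1/4, 81/169) = (169/676,
  -- 324/676).
  have key : ∀ z ∈ Set.Ioo (1 / 2 : ℝ) (9 / 13),
      0 < (676 * z ^ 2 - 169) / (324 - 676 * z ^ 2) ∧
      coeffEval [676, 676] ((676 * z ^ 2 - 169) / (324 - 676 * z ^ 2)) ≠ 0 ∧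
      z ^ 2 = coeffEval [169, 324] ((676 * z ^ 2 - 169) / (324 - 676 * z ^ 2)) /
        coeffEval [676, 676] ((676 * z ^ 2 - 169) / (324 - 676 * z ^ 2)) := by
    rintro z ⟨h1, h2⟩
    have h3 : 0 < 324 - 676 * z ^ 2 := by nlinarith
    have h4 : 0 < (676 * z ^ 2 - 169) / (324 - 676 * z ^ 2) := div_pos (by nlinarith) h3
    refine ⟨h4, ?_, ?_⟩
    · simp only [coeffEval_cons, coeffEval_nil]; push_cast; positivity
    · have h5 : 676 + (676 * z ^ 2 - 169) / (324 - 676 * z ^ 2) * 676 ≠ 0 := by positivity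
      simp only [coeffEval_cons, coeffEval_nil]
      push_cast
      simp only [mul_zero, add_zero]
      rw [eq_div_iff h5]
      linear_combination -div_mul_cancel₀ (676 * z ^ 2 - 169) h3.ne'
  obtain ⟨hu, hgu, hxu⟩ := key x hx
  obtain ⟨hv, hgv, hyv⟩ := key y hy
  rw [p₄_eq_coeffEval] at hpx hpy
  -- The transformed list has 22 entries, and only the leading one is negative.
  have h := coeffEval_root_unique (l := coeffP₄) (n := 20) (by decide +kernel) (by decide +kernel)
    (by decide +kernel) hu hv hgu hgv hxu hyv hpx hpy
  have hx0 : (0 : ℝ) ≤ x := by linarith [hx.1]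
  have hy0 : (0 : ℝ) ≤ y := by linarith [hy.1]
  exact (pow_left_inj₀ hx0 hy0 two_ne_zero).1 h

/-- The bracket is much narrower than ten decimals require, since the bounds on k₀ are derived from
it through t¹² (1 - t)¹¹. -/
theorem exists_p₂_root :
    ∃ t ∈ Set.Ioo (0.5194285604811 : ℝ) 0.5194285604812, p₂ t = 0 := by
  have h1 : 0 < p₂ 0.5194285604811 := by norm_num [p₂]
  have h2 : p₂ 0.5194285604812 < 0 := by norm_num [p₂]
  have hc : ContinuousOn p₂ (Set.Icc 0.5194285604811 0.5194285604812) := by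
    unfold p₂; fun_prop
  obtain ⟨t, ht, h0⟩ := intermediate_value_Ioo' (by norm_num) hc ⟨h2, h1⟩
  exact ⟨t, ht, h0⟩

/-! ### Elimination modulo `p₂`

As `p₂` has constant term `-1`, the ring of integer polynomials in `1 / t` with `p₂ t = 0` is free
of rank 20, and division by `t` acts on coefficient lists. Integers are kept as differences of
natural numbers, which the kernel evaluates fast. -/

/-- Evaluation of a polynomial with natural coefficients, constant term first. -/
def natEval (l : List ℕ) (x : ℝ) : ℝ := l.foldr (fun c s ↦ c + x * s) 0

@[simp] theorem natEval_nil (x : ℝ) : natEval [] x = 0 := rfl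

@[simp] theorem natEval_cons (c : ℕ) (l : List ℕ) (x : ℝ) :
    natEval (c :: l) x = c + x * natEval l x := rfl

theorem natEval_headD_tail (l : List ℕ) (x : ℝ) :
    natEval l x = l.headD 0 + x * natEval l.tail x := by
  cases l <;> simp

theorem natEval_map_mul (a : ℕ) (l : List ℕ) (x : ℝ) :
    natEval (l.map (Nat.mul a)) x = a * natEval l x := by
  induction l with
  | nil => simp
  | cons c l ih => simp [ih]; ring

/-- Sum of lists of natural coefficients. -/
def natAdd : List ℕ → List ℕ → List ℕ
  | [], m => m
  | l, [] => l
  | a :: l, b :: m => Nat.add a b :: natAdd l m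

theorem natEval_natAdd (l m : List ℕ) (x : ℝ) :
    natEval (natAdd l m) x = natEval l x + natEval m x := by
  fun_induction natAdd l m with
  | case1 => simp
  | case2 => simp
  | case3 a l b m ih => simp [ih]; ring

/-- The linear combination `p + a * q + b * r`. -/
def natComb (a b : ℕ) : List ℕ → List ℕ → List ℕ → List ℕ
  | c :: p, d :: q, e :: r => Nat.add c (Nat.add (Nat.mul a d) (Nat.mul b e)) :: natComb a b p q r
  | p, q, r => natAdd p (natAdd (q.map (Nat.mul a)) (r.map (Nat.mul b)))

theorem natEval_natComb (a b : ℕ) (p q r : List ℕ) (x : ℝ) :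
    natEval (natComb a b p q r) x = natEval p x + a * natEval q x + b * natEval r x := by
  fun_induction natComb a b p q r with
  | case1 c p d q e r ih => simp [ih]; ring
  | case2 => simp only [natEval_natAdd, natEval_map_mul]; ring

/-- Evaluation of a difference of polynomials with natural coefficients. -/
def diffEval (v : List ℕ × List ℕ) (x : ℝ) : ℝ := natEval v.1 x - natEval v.2 x

/-- The linear combination `v + (a - b) * w`. -/
def diffComb (a b : ℕ) (v w : List ℕ × List ℕ) : List ℕ × List ℕ :=
  (natComb a b v.1 w.1 w.2, natComb a b v.2 w.2 w.1)

theorem diffEval_diffComb (a b : ℕ) (v w : List ℕ × List ℕ) (x : ℝ) :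
    diffEval (diffComb a b v w) x = diffEval v x + (a - b) * diffEval w x := by
  simp only [diffEval, diffComb, natEval_natComb]; ring

/-- Division by `t` modulo `m t = 1 / t`. -/
def diffDivX (m v : List ℕ × List ℕ) : List ℕ × List ℕ :=
  diffComb (v.1.headD 0) (v.2.headD 0) (v.1.tail, v.2.tail) m

theorem diffEval_diffDivX {m : List ℕ × List ℕ} {t : ℝ} (ht : t ≠ 0) (hm : diffEval m t = t⁻¹)
    (v : List ℕ × List ℕ) : diffEval (diffDivX m v) t = t⁻¹ * diffEval v t := by
  rw [diffDivX, diffEval_diffComb, hm]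
  simp only [diffEval]
  rw [natEval_headD_tail v.1, natEval_headD_tail v.2]
  field_simp
  ring

/-- Iteration of a map on pairs of coefficient lists. -/
def diffIter (f : List ℕ × List ℕ → List ℕ × List ℕ) : ℕ → List ℕ × List ℕ → List ℕ × List ℕ
  | 0, v => v
  | n + 1, v => diffIter f n (f v)

theorem diffEval_diffIter {f : List ℕ × List ℕ → List ℕ × List ℕ} {t a : ℝ}
    (hf : ∀ v, diffEval (f v) t = a * diffEval v t) (n : ℕ) (v : List ℕ × List ℕ) :
    diffEval (diffIter f n v) t = a ^ n * diffEval v t := by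
  induction n generalizing v with
  | zero => simp [diffIter]
  | succ n ih => rw [diffIter, ih, hf]; ring

/-- Multiplication by `(1 / t + 1) * (1 / t) ^ 22`. -/
def diffNum (m v : List ℕ × List ℕ) : List ℕ × List ℕ :=
  diffIter (fun w ↦ diffComb 1 0 w (diffDivX m w)) 1 (diffIter (diffDivX m) 22 v)

/-- Multiplication by `5120 ^ 2 * (1 / t - 1) ^ 11`. -/
def diffDen (m v : List ℕ × List ℕ) : List ℕ × List ℕ :=
  diffComb 26214400 0 ([], []) (diffIter (fun w ↦ diffComb 0 1 (diffDivX m w) w) 11 v)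

theorem diffEval_diffNum {m : List ℕ × List ℕ} {t : ℝ} (ht : t ≠ 0) (hm : diffEval m t = t⁻¹)
    (v : List ℕ × List ℕ) :
    diffEval (diffNum m v) t = (t⁻¹ + 1) * t⁻¹ ^ 22 * diffEval v t := by
  have h (w : List ℕ × List ℕ) :
      diffEval (diffComb 1 0 w (diffDivX m w)) t = (t⁻¹ + 1) * diffEval w t := by
    rw [diffEval_diffComb, diffEval_diffDivX ht hm]; push_cast; ring
  rw [diffNum, diffEval_diffIter h, diffEval_diffIter (diffEval_diffDivX ht hm)]
  ring

theorem diffEval_diffDen {m : List ℕ × List ℕ} {t : ℝ} (ht : t ≠ 0) (hm : diffEval m t = t⁻¹)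
    (v : List ℕ × List ℕ) :
    diffEval (diffDen m v) t = 5120 ^ 2 * (t⁻¹ - 1) ^ 11 * diffEval v t := by
  have h (w : List ℕ × List ℕ) :
      diffEval (diffComb 0 1 (diffDivX m w) w) t = (t⁻¹ - 1) * diffEval w t := by
    rw [diffEval_diffComb, diffEval_diffDivX ht hm]; push_cast; ring
  rw [diffDen, diffEval_diffComb, diffEval_diffIter h]
  simp only [diffEval, natEval_nil]
  push_cast
  ring

/-- Equality test for coefficient lists. -/
def natListEq : List ℕ → List ℕ → Bool
  | [], [] => true
  | c :: p, d :: q => Nat.beq c d && natListEq p q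
  | _, _ => false

theorem natListEq_self (p : List ℕ) : natListEq p p = true := by
  induction p with
  | nil => rfl
  | cons c p ih => simp [natListEq, ih]

theorem eq_of_natListEq {p q : List ℕ} (h : natListEq p q = true) : p = q := by
  fun_induction natListEq p q with
  | case1 => rfl
  | case2 c p d q ih =>
    rw [Bool.and_eq_true] at h
    rw [ih h.2, Nat.eq_of_beq_eq_true h.1]
  | case3 => simp at h

/-- Horner evaluation of a polynomial, leading coefficient first, at the quotient of the elements of
`diffNum` and `diffDen`. The test makes the kernel evaluate the coefficients after each step. -/
def diffHorner (m : List ℕ × List ℕ) : List ℤ → List ℕ × List ℕ → List ℕ × List ℕ →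
    List ℕ × List ℕ
  | [], v, _ => v
  | c :: l, v, e =>
    bif natListEq (natAdd v.1 v.2) (natAdd v.1 v.2) then
      diffHorner m l (diffComb c.toNat (-c).toNat (diffNum m v) (diffDen m e)) (diffDen m e)
    else v

/-- Horner's scheme with cleared denominators: writing κ = N/D, the accumulator `e` carries the
powers of D, so no division in the quotient ring is needed. Each new coefficient is also multiplied
by D, hence the common factor D^`l.length`. -/
theorem diffEval_diffHorner {m : List ℕ × List ℕ} {t κ : ℝ} (ht : t ≠ 0)
    (hm : diffEval m t = t⁻¹)
    (hκ : κ * (5120 ^ 2 * (t⁻¹ - 1) ^ 11) = (t⁻¹ + 1) * t⁻¹ ^ 22) (l : List ℤ)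
    (v e : List ℕ × List ℕ) :
    diffEval (diffHorner m l v e) t = (5120 ^ 2 * (t⁻¹ - 1) ^ 11) ^ l.length *
      (κ ^ l.length * diffEval v t + diffEval e t * coeffEval l.reverse κ) := by
  induction l generalizing v e with
  | nil => simp [diffHorner]
  | cons c l ih =>
    have hc : ((c.toNat : ℝ) - ((-c).toNat : ℝ)) = c := by
      exact_mod_cast Int.toNat_sub_toNat_neg c
    rw [diffHorner, natListEq_self, cond_true, ih, diffEval_diffComb, hc, diffEval_diffNum ht hm,
      diffEval_diffDen ht hm, List.reverse_cons, coeffEval_append, ← hκ]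
    simp only [List.length_cons, List.length_reverse, coeffEval_cons, coeffEval_nil]
    ring

/-- The coefficients of `(p₂ t + 1) / t`. -/
def invCoeff : List ℕ × List ℕ :=
  (coeffP₂.tail.map Int.toNat, coeffP₂.tail.map fun c ↦ (-c).toNat)

/-- Since p₂ has constant term -1, its vanishing at t says that t times the remaining part equals 1.
-/
theorem diffEval_invCoeff {t : ℝ} (ht : t ≠ 0) (h : p₂ t = 0) : diffEval invCoeff t = t⁻¹ := by
  have hl (l : List ℤ) :
      diffEval (l.map Int.toNat, l.map fun c ↦ (-c).toNat) t = coeffEval l t := by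
    induction l with
    | nil => simp [diffEval]
    | cons c l ih =>
      have hc : ((c.toNat : ℝ) - ((-c).toNat : ℝ)) = c := by
        exact_mod_cast Int.toNat_sub_toNat_neg c
      simp only [diffEval, List.map_cons, natEval_cons, coeffEval_cons] at ih ⊢
      rw [← ih, ← hc]; ring
  rw [invCoeff, hl]
  rw [p₂_eq_coeffEval, coeffP₂, coeffEval_cons] at h
  rw [coeffP₂, List.tail_cons]
  push_cast at h
  field_simp
  linarith

/-- The elimination itself: with κ = k² and D = 5120² (1/t - 1)¹¹, the element D²¹ p₄(k), reduced
modulo p₂, has equal positive and negative parts. -/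
theorem natListEq_diffHorner :
    natListEq (diffHorner invCoeff coeffP₄.reverse ([], []) ([1], [])).1
      (diffHorner invCoeff coeffP₄.reverse ([], []) ([1], [])).2 = true := by
  decide +kernel

/-- If `t` is a root of `p₂` then `(1 + t) / (5120 ^ 2 * t ^ 12 * (1 - t) ^ 11)` is the square of a
root of `p₄`. -/
theorem p₄_eq_zero {t k : ℝ} (ht : t ≠ 0) (ht1 : t ≠ 1) (h : p₂ t = 0)
    (hk : k ^ 2 * (5120 ^ 2 * t ^ 12 * (1 - t) ^ 11) = 1 + t) : p₄ k = 0 := by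
  have h1 : t⁻¹ - 1 ≠ 0 := by
    rw [sub_ne_zero, ne_eq, inv_eq_one]; exact ht1
  have hκ : k ^ 2 * (5120 ^ 2 * (t⁻¹ - 1) ^ 11) = (t⁻¹ + 1) * t⁻¹ ^ 22 := by
    have e1 : t⁻¹ - 1 = (1 - t) / t := by field_simp
    have e2 : t⁻¹ + 1 = (1 + t) / t := by field_simp
    rw [e1, e2, ← hk]
    field_simp
  have key := diffEval_diffHorner ht (diffEval_invCoeff ht h) hκ coeffP₄.reverse ([], []) ([1], [])
  rw [diffEval, eq_of_natListEq natListEq_diffHorner, sub_self, List.reverse_reverse,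
    ← p₄_eq_coeffEval] at key
  simpa [diffEval, h1] using key.symm

/-! ### The one-variable inequality -/

/-- The ratio `p / r` of a triangle with sides `2 * t`, `1`, `1`. -/
noncomputable def isoscelesRatio (t : ℝ) : ℝ := (1 + t) ^ 2 / (t * √(1 - t ^ 2))

theorem one_sub_sq_pos {t : ℝ} (h0 : 0 < t) (h1 : t < 1) : 0 < 1 - t ^ 2 := by nlinarith

theorem isoscelesRatio_pos {t : ℝ} (h0 : 0 < t) (h1 : t < 1) : 0 < isoscelesRatio t := by
  have := Real.sqrt_pos.2 (one_sub_sq_pos h0 h1)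
  unfold isoscelesRatio; positivity

theorem isoscelesRatio_sq {t : ℝ} (h0 : 0 < t) (h1 : t < 1) :
    isoscelesRatio t ^ 2 * (t ^ 2 * (1 - t)) = (1 + t) ^ 3 := by
  have h2 := one_sub_sq_pos h0 h1
  have h3 : 1 - t ≠ 0 := by linarith
  have h4 : 1 + t ≠ 0 := by linarith
  rw [isoscelesRatio, div_pow, mul_pow, Real.sq_sqrt h2.le,
    show 1 - t ^ 2 = (1 - t) * (1 + t) by ring]
  field_simp

theorem hasDerivAt_isoscelesRatio {t : ℝ} (h0 : 0 < t) (h1 : t < 1) :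
    HasDerivAt isoscelesRatio (isoscelesRatio t * (2 * t - 1) / (t * (1 - t ^ 2))) t := by
  have h2 := one_sub_sq_pos h0 h1
  have hs := Real.sqrt_pos.2 h2
  have hsq := Real.sq_sqrt h2.le
  have hd1 : HasDerivAt (fun t : ℝ ↦ (1 + t) ^ 2) (2 * (1 + t)) t := by
    refine (((hasDerivAt_id t).const_add 1).pow 2).congr_deriv ?_
    simp
  have hd2 : HasDerivAt (fun t : ℝ ↦ √(1 - t ^ 2)) (-(2 * t) / (2 * √(1 - t ^ 2))) t := by
    have : HasDerivAt (fun t : ℝ ↦ 1 - t ^ 2) (-(2 * t)) t := by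
      simpa using (hasDerivAt_pow 2 t).const_sub 1
    exact this.sqrt h2.ne'
  have hd3 := hd1.div ((hasDerivAt_id t).mul hd2) (mul_pos h0 hs).ne'
  refine hd3.congr_deriv ?_
  simp only [id, isoscelesRatio, Pi.mul_apply]
  set s := √(1 - t ^ 2)
  rw [← hsq]
  field_simp
  rw [hsq]
  ring

/-- The excess of `p / r` over `3 * √3 + k * (1 - (2 * r / R) ^ 5)` for a triangle with sides
`2 * t`, `1`, `1`. -/
noncomputable def isoscelesExcess (k t : ℝ) : ℝ :=
  isoscelesRatio t - 3 * √3 - k * (1 - (4 * t * (1 - t)) ^ 5)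

/-- Both p/r and q are stationary at the equilateral shape, so 2t - 1 factors out and the bracket
governs the sign. The constant is 5120 = 5 · 4⁵. -/
theorem hasDerivAt_isoscelesExcess (k : ℝ) {t : ℝ} (h0 : 0 < t) (h1 : t < 1) :
    HasDerivAt (isoscelesExcess k) ((2 * t - 1) / (t * (1 - t ^ 2)) *
      (isoscelesRatio t - 5120 * k * (t * (1 - t)) ^ 5 * (1 + t))) t := by
  have h2 := one_sub_sq_pos h0 h1
  have hd1 : HasDerivAt (fun t : ℝ ↦ 4 * t * (1 - t)) (4 - 8 * t) t := by
    refine (((hasDerivAt_id t).const_mul 4).mul ((hasDerivAt_id t).const_sub 1)).congr_deriv ?_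
    simp only [id]; ring
  refine (((hasDerivAt_isoscelesRatio h0 h1).sub_const (3 * √3)).sub
    (((hd1.pow 5).const_sub 1).const_mul k)).congr_deriv ?_
  field_simp
  ring

/-- The function deciding the sign of the derivative of `isoscelesExcess`. -/
noncomputable def critical (t : ℝ) : ℝ := 5120 ^ 2 * t ^ 12 * (1 - t) ^ 11 / (1 + t)

theorem hasDerivAt_critical {t : ℝ} (h0 : 0 < t) :
    HasDerivAt critical (5120 ^ 2 * t ^ 11 * (1 - t) ^ 10 / (1 + t) ^ 2 *
      (2 * (6 - 6 * t - 11 * t ^ 2))) t := by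
  have hd1 : HasDerivAt (fun t : ℝ ↦ 5120 ^ 2 * t ^ 12 * (1 - t) ^ 11)
      (5120 ^ 2 * (12 * t ^ 11) * (1 - t) ^ 11 +
        5120 ^ 2 * t ^ 12 * (11 * (1 - t) ^ 10 * -1)) t := by
    refine (((hasDerivAt_pow 12 t).const_mul (5120 ^ 2)).mul
      (((hasDerivAt_id t).const_sub 1).pow 11)).congr_deriv ?_
    simp
  refine (hd1.div ((hasDerivAt_id t).const_add 1) (by positivity)).congr_deriv ?_
  simp only [id]
  field_simp
  ring

/-- The maximum point of `critical` on `(0, 1)`. -/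
noncomputable def criticalMax : ℝ := (5 * √3 - 3) / 11

/-- The upper bound places t₁ ≈ 0.5194 on the decreasing branch of `critical`. -/
theorem criticalMax_mem : criticalMax ∈ Set.Ioo (0.51 : ℝ) 0.519 := by
  have h1 : (1.732 : ℝ) < √3 := Real.lt_sqrt_of_sq_lt (by norm_num)
  have h2 : √3 < (1.733 : ℝ) := (Real.sqrt_lt' (by norm_num)).2 (by norm_num)
  constructor <;> unfold criticalMax <;> linarith

theorem criticalMax_root : 6 - 6 * criticalMax - 11 * criticalMax ^ 2 = 0 := by
  have h := Real.sq_sqrt (show (0 : ℝ) ≤ 3 by norm_num)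
  unfold criticalMax
  linear_combination (-25 / 11 : ℝ) * h

theorem critical_strictMonoOn : StrictMonoOn critical (Set.Icc (1 / 2) criticalMax) := by
  have hm := criticalMax_mem
  refine strictMonoOn_of_deriv_pos (convex_Icc _ _) (fun t ht ↦ ?_) fun t ht ↦ ?_
  · exact (hasDerivAt_critical (by linarith [ht.1])).continuousAt.continuousWithinAt
  · rw [interior_Icc] at ht
    have h0 : 0 < t := by linarith [ht.1]
    have h1 : 0 < 1 - t := by linarith [ht.2, hm.2]
    rw [(hasDerivAt_critical h0).deriv]
    have := criticalMax_root
    have : 0 < 6 - 6 * t - 11 * t ^ 2 := by nlinarith [ht.2]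
    positivity

theorem critical_strictAntiOn : StrictAntiOn critical (Set.Ico criticalMax 1) := by
  have hm := criticalMax_mem
  refine strictAntiOn_of_deriv_neg (convex_Ico _ _) (fun t ht ↦ ?_) fun t ht ↦ ?_
  · exact (hasDerivAt_critical (by linarith [ht.1, hm.1])).continuousAt.continuousWithinAt
  · rw [interior_Ico] at ht
    have h0 : 0 < t := by linarith [ht.1, hm.1]
    have h1 : 0 < 1 - t := by linarith [ht.2]
    rw [(hasDerivAt_critical h0).deriv]
    have := criticalMax_root
    have : 6 - 6 * t - 11 * t ^ 2 < 0 := by nlinarith [ht.1, hm.1]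
    have h3 : 0 < 5120 ^ 2 * t ^ 11 * (1 - t) ^ 10 / (1 + t) ^ 2 := by positivity
    nlinarith

/-- Squaring removes the root in `isoscelesRatio` and turns the sign of the derivative into a
comparison of k² `critical t` with 1. -/
theorem isoscelesRatio_sq_sub (k : ℝ) {t : ℝ} (h0 : 0 < t) (h1 : t < 1) :
    isoscelesRatio t ^ 2 - (5120 * k * (t * (1 - t)) ^ 5 * (1 + t)) ^ 2 =
      (1 + t) ^ 3 / (t ^ 2 * (1 - t)) * (1 - k ^ 2 * critical t) := by
  have h2 : 0 < 1 - t := by linarith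
  rw [eq_div_of_mul_eq (by positivity) (isoscelesRatio_sq h0 h1), critical]
  field_simp

theorem lt_isoscelesRatio_iff {k : ℝ} (hk : 0 ≤ k) {t : ℝ} (h0 : 0 < t) (h1 : t < 1) :
    5120 * k * (t * (1 - t)) ^ 5 * (1 + t) < isoscelesRatio t ↔ k ^ 2 * critical t < 1 := by
  have h2 : 0 < 1 - t := by linarith
  rw [← pow_lt_pow_iff_left₀ (by positivity) (isoscelesRatio_pos h0 h1).le two_ne_zero, ← sub_pos,
    isoscelesRatio_sq_sub k h0 h1, mul_pos_iff_of_pos_left (by positivity), sub_pos]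

theorem isoscelesRatio_lt_iff {k : ℝ} (hk : 0 ≤ k) {t : ℝ} (h0 : 0 < t) (h1 : t < 1) :
    isoscelesRatio t < 5120 * k * (t * (1 - t)) ^ 5 * (1 + t) ↔ 1 < k ^ 2 * critical t := by
  have h2 : 0 < 1 - t := by linarith
  rw [← pow_lt_pow_iff_left₀ (isoscelesRatio_pos h0 h1).le (by positivity) two_ne_zero, ← sub_neg,
    isoscelesRatio_sq_sub k h0 h1, ← sub_neg (a := (1 : ℝ)), ← neg_pos, ← mul_neg,
    mul_pos_iff_of_pos_left (by positivity), neg_pos]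

theorem isoscelesExcess_strictMonoOn {k : ℝ} (hk : 0 ≤ k) {D : Set ℝ} (hD : Convex ℝ D)
    (hD1 : D ⊆ Set.Ico (1 / 2) 1) (h : ∀ t ∈ interior D, k ^ 2 * critical t < 1) :
    StrictMonoOn (isoscelesExcess k) D := by
  refine strictMonoOn_of_deriv_pos hD (fun t ht ↦ ?_) fun t ht ↦ ?_
  · have := hD1 ht
    exact (hasDerivAt_isoscelesExcess k (by linarith [this.1])
      this.2).continuousAt.continuousWithinAt
  · have h3 : t ∈ Set.Ioo (1 / 2 : ℝ) 1 := by simpa using interior_mono hD1 ht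
    have h0 : 0 < t := by linarith [h3.1]
    rw [(hasDerivAt_isoscelesExcess k h0 h3.2).deriv]
    have h4 := one_sub_sq_pos h0 h3.2
    have h5 := (lt_isoscelesRatio_iff hk h0 h3.2).2 (h t ht)
    have h6 : 0 < 2 * t - 1 := by linarith [h3.1]
    exact mul_pos (by positivity) (sub_pos.2 h5)

theorem isoscelesExcess_strictAntiOn {k : ℝ} (hk : 0 ≤ k) {D : Set ℝ} (hD : Convex ℝ D)
    (hD1 : D ⊆ Set.Ico (1 / 2) 1) (h : ∀ t ∈ interior D, 1 < k ^ 2 * critical t) :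
    StrictAntiOn (isoscelesExcess k) D := by
  refine strictAntiOn_of_deriv_neg hD (fun t ht ↦ ?_) fun t ht ↦ ?_
  · have := hD1 ht
    exact (hasDerivAt_isoscelesExcess k (by linarith [this.1])
      this.2).continuousAt.continuousWithinAt
  · have h3 : t ∈ Set.Ioo (1 / 2 : ℝ) 1 := by simpa using interior_mono hD1 ht
    have h0 : 0 < t := by linarith [h3.1]
    rw [(hasDerivAt_isoscelesExcess k h0 h3.2).deriv]
    have h4 := one_sub_sq_pos h0 h3.2
    have h5 := (isoscelesRatio_lt_iff hk h0 h3.2).2 (h t ht)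
    have h6 : 0 < 2 * t - 1 := by linarith [h3.1]
    exact mul_neg_of_pos_of_neg (by positivity) (sub_neg.2 h5)

theorem isoscelesExcess_half (k : ℝ) : isoscelesExcess k (1 / 2) = 0 := by
  have h : isoscelesRatio (1 / 2) = 3 * √3 := by
    have h1 := isoscelesRatio_sq (t := 1 / 2) (by norm_num) (by norm_num)
    have h2 := isoscelesRatio_pos (t := 1 / 2) (by norm_num) (by norm_num)
    have h3 := Real.sq_sqrt (show (0 : ℝ) ≤ 3 by norm_num)
    refine (pow_left_inj₀ h2.le (by positivity) two_ne_zero).1 ?_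
    linear_combination 8 * h1 - 9 * h3
  rw [isoscelesExcess, h]
  norm_num

/-! ### The extremal pair and the sign of its excess. -/

/-- The parameter `t₁` and the constant `k₀` of the extremal isosceles triangle. -/
structure IsExtremal (k t : ℝ) : Prop where
  gt : 0.5194285604811 < t
  lt : t < 0.5194285604812
  root : p₂ t = 0
  pos : 0 < k
  sq_mul : k ^ 2 * (5120 ^ 2 * t ^ 12 * (1 - t) ^ 11) = 1 + t

theorem exists_isExtremal : ∃ k t, IsExtremal k t := by
  obtain ⟨t, ⟨h1, h2⟩, h3⟩ := exists_p₂_root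
  have h4 : 0 < t := by linarith
  have h5 : 0 < 1 - t := by linarith
  refine ⟨√((1 + t) / (5120 ^ 2 * t ^ 12 * (1 - t) ^ 11)), t, h1, h2, h3,
    Real.sqrt_pos.2 (by positivity), ?_⟩
  rw [Real.sq_sqrt (by positivity)]
  field_simp

namespace IsExtremal

variable {k t : ℝ}

theorem sq_mul_critical (h : IsExtremal k t) : k ^ 2 * critical t = 1 := by
  have := h.gt
  rw [critical, mul_div_assoc', h.sq_mul, div_self (by linarith)]

theorem sq_mem (h : IsExtremal k t) :
    k ^ 2 ∈ Set.Ioo (0.68983697067 ^ 2 : ℝ) (0.68983697072 ^ 2) := by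
  have h1 := h.gt
  have h2 := h.lt
  have h3 : 0 < 1 - t := by linarith
  have hlow : (0.5194285604811 ^ 12 * (1 - 0.5194285604812) ^ 11 : ℝ) ≤ t ^ 12 * (1 - t) ^ 11 := by
    gcongr
  have hup : t ^ 12 * (1 - t) ^ 11 ≤ (0.5194285604812 ^ 12 * (1 - 0.5194285604811) ^ 11 : ℝ) := by
    gcongr
  have h4 := h.sq_mul
  rw [mul_assoc (5120 ^ 2 : ℝ)] at h4
  set d := t ^ 12 * (1 - t) ^ 11
  constructor
  · by_contra! hle
    have : k ^ 2 * (5120 ^ 2 * d) ≤ 0.68983697067 ^ 2 *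
      (5120 ^ 2 * (0.5194285604812 ^ 12 * (1 - 0.5194285604811) ^ 11)) := by gcongr
    norm_num at this
    linarith
  · by_contra! hle
    have : 0.68983697072 ^ 2 * (5120 ^ 2 * (0.5194285604811 ^ 12 * (1 - 0.5194285604812) ^ 11)) ≤
      k ^ 2 * (5120 ^ 2 * d) := by gcongr
    norm_num at this
    linarith

theorem mem (h : IsExtremal k t) : k ∈ Set.Ioo (0.68983697067 : ℝ) 0.68983697072 :=
  ⟨lt_of_pow_lt_pow_left₀ 2 h.pos.le h.sq_mem.1, lt_of_pow_lt_pow_left₀ 2 (by norm_num) h.sq_mem.2⟩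

/-- The field `sq_mul` is the stationarity condition; with it p/r can be replaced by a polynomial
multiple of k, and p₂(t) = 0 supplies the remaining equation `hS`. -/
theorem isoscelesExcess_eq_zero (h : IsExtremal k t) : isoscelesExcess k t = 0 := by
  have h1 := h.gt
  have h2 := h.lt
  have hk := h.pos
  have h0 : 0 < t := by linarith
  have h3 : 0 < 1 - t := by linarith
  have hG : isoscelesRatio t = 5120 * k * (t * (1 - t)) ^ 5 * (1 + t) := by
    refine (pow_left_inj₀ (isoscelesRatio_pos h0 (by linarith)).le (by positivity) two_ne_zero).1 ?_
    rw [← sub_eq_zero, isoscelesRatio_sq_sub k h0 (by linarith), h.sq_mul_critical, sub_self,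
      mul_zero]
  -- A root of p₂ gives only the square of `hS`; this bound fixes the sign, so that the square root
  -- can be taken.
  have hw : (0.249 : ℝ) ≤ t * (1 - t) := by nlinarith
  have hA : 0 < 1024 * (t * (1 - t)) ^ 5 * (6 + 5 * t) - 1 := by
    have : (0.249 : ℝ) ^ 5 ≤ (t * (1 - t)) ^ 5 := by gcongr
    nlinarith
  have hS : k * (1024 * (t * (1 - t)) ^ 5 * (6 + 5 * t) - 1) = 3 * √3 := by
    refine (pow_left_inj₀ (by positivity) (by positivity) two_ne_zero).1 ?_
    -- This is where p₂ comes from: the difference of the two sides is (2t - 1)³ p₂(t).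
    have h5 : (1 + t) * (1024 * (t * (1 - t)) ^ 5 * (6 + 5 * t) - 1) ^ 2 =
        27 * (5120 ^ 2 * t ^ 12 * (1 - t) ^ 11) := by
      have := h.root
      unfold p₂ at this
      linear_combination (2 * t - 1) ^ 3 * this
    have h6 := Real.sq_sqrt (show (0 : ℝ) ≤ 3 by norm_num)
    refine mul_left_cancel₀ (show 1 + t ≠ 0 by linarith) ?_
    rw [mul_pow k, mul_pow 3, h6]
    linear_combination k ^ 2 * h5 + 27 * h.sq_mul
  rw [isoscelesExcess, hG, ← hS]
  ring

/-- The graph of k² `critical` crosses level 1 upwards at some u < `criticalMax` and downwards at t.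
So the excess increases on [1/2, u], decreases on [u, t] and increases on [t, 1), with value 0 at
1/2 and at t. -/
theorem isoscelesExcess_pos (h : IsExtremal k t) {s : ℝ} (hs : 1 / 2 < s) (hs1 : s < 1)
    (hst : s ≠ t) : 0 < isoscelesExcess k s := by
  have h1 := h.gt
  have h2 := h.lt
  have hm := criticalMax_mem
  have hk := pow_pos h.pos 2
  have hct := h.sq_mul_critical
  have hlt : k ^ 2 * critical (1 / 2) < 1 := by
    have := h.sq_mem.2
    norm_num [critical] at this ⊢
    linarith
  have hgt : 1 < k ^ 2 * critical criticalMax := by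
    rw [← hct]
    exact mul_lt_mul_of_pos_left (critical_strictAntiOn ⟨le_rfl, by linarith [hm.2]⟩
      ⟨by linarith [hm.2], by linarith⟩ (by linarith [hm.2])) hk
  obtain ⟨u, ⟨hu1, hu2⟩, hu⟩ : ∃ u ∈ Set.Ioo (1 / 2) criticalMax, k ^ 2 * critical u = 1 := by
    refine intermediate_value_Ioo (f := fun u ↦ k ^ 2 * critical u) (by linarith [hm.1])
      (fun u hu ↦ ?_) ⟨hlt, hgt⟩
    exact ((hasDerivAt_critical (by linarith [hu.1])).continuousAt.const_mul
      _).continuousWithinAt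
  rcases lt_or_gt_of_ne hst with hlt' | hgt'
  · rcases le_or_gt s u with hsu | hus
    · rw [← isoscelesExcess_half k]
      refine isoscelesExcess_strictMonoOn h.pos.le (convex_Icc (1 / 2) u) (fun x hx ↦ ?_)
        (fun x hx ↦ ?_) ⟨le_rfl, hu1.le⟩ ⟨hs.le, hsu⟩ hs
      · exact ⟨hx.1, by linarith [hx.2, hm.2]⟩
      · rw [interior_Icc] at hx
        rw [← hu]
        exact mul_lt_mul_of_pos_left (critical_strictMonoOn ⟨hx.1.le, (hx.2.trans hu2).le⟩
          ⟨hu1.le, hu2.le⟩ hx.2) hk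
    · rw [← h.isoscelesExcess_eq_zero]
      refine isoscelesExcess_strictAntiOn h.pos.le (convex_Icc u t) (fun x hx ↦ ?_)
        (fun x hx ↦ ?_) ⟨hus.le, hlt'.le⟩ ⟨(hus.trans hlt').le, le_rfl⟩ hlt'
      · exact ⟨hu1.le.trans hx.1, by linarith [hx.2]⟩
      · rw [interior_Icc] at hx
        rcases le_or_gt x criticalMax with hxm | hxm
        · rw [← hu]
          exact mul_lt_mul_of_pos_left (critical_strictMonoOn ⟨hu1.le, hu2.le⟩
            ⟨(hu1.trans hx.1).le, hxm⟩ hx.1) hk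
        · rw [← hct]
          exact mul_lt_mul_of_pos_left (critical_strictAntiOn ⟨hxm.le, by linarith [hx.2]⟩
            ⟨by linarith [hm.2], by linarith⟩ hx.2) hk
  · rw [← h.isoscelesExcess_eq_zero]
    refine isoscelesExcess_strictMonoOn h.pos.le (convex_Ico t 1) (fun x hx ↦ ?_)
      (fun x hx ↦ ?_) ⟨le_rfl, by linarith⟩ ⟨hgt'.le, hs1⟩ hgt'
    · exact ⟨by linarith [hx.1], hx.2⟩
    · rw [interior_Ico] at hx
      rw [← hct]
      exact mul_lt_mul_of_pos_left (critical_strictAntiOn ⟨by linarith [hm.2], by linarith⟩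
        ⟨by linarith [hm.2, hx.1], hx.2⟩ hx.1) hk

end IsExtremal

/-! ### Heron-type formulas for the inradius and the circumradius -/

namespace Affine.Triangle

open EuclideanGeometry
open scoped RealInnerProductSpace

variable {V P : Type*} [NormedAddCommGroup V] [InnerProductSpace ℝ V] [MetricSpace P]
  [NormedAddTorsor V P]

/-- Both sides are four times the squared area; the right one is the Gram determinant of two edge
vectors. The proof eliminates the unknown position of the altitude foot on the opposite line from
two inner-product formulas for the height. -/
theorem height_sq_mul_dist_sq (T : Triangle ℝ P) {i j k : Fin 3} (hij : i ≠ j) (hik : i ≠ k)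
    (hjk : j ≠ k) :
    T.height i ^ 2 * dist (T.points j) (T.points k) ^ 2 =
      dist (T.points i) (T.points j) ^ 2 * dist (T.points j) (T.points k) ^ 2 -
        ((dist (T.points i) (T.points j) ^ 2 + dist (T.points j) (T.points k) ^ 2 -
          dist (T.points i) (T.points k) ^ 2) / 2) ^ 2 := by
  have h1 := T.inner_vsub_vsub_altitudeFoot_eq_height_sq hij
  have h2 := T.inner_vsub_vsub_altitudeFoot_eq_height_sq hik
  have hmem := T.altitudeFoot_mem_affineSpan_image_compl i
  have hc : ({i}ᶜ : Set (Fin 3)) = {j, k} := by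
    ext l
    simp only [Set.mem_compl_iff, Set.mem_singleton_iff, Set.mem_insert_iff]
    omega
  rw [hc, Set.image_pair] at hmem
  obtain ⟨s, hs⟩ := mem_affineSpan_pair_iff_exists_lineMap_eq.1 hmem
  rw [← hs] at h1 h2
  have e1 : T.points i -ᵥ AffineMap.lineMap (T.points j) (T.points k) s =
      (T.points i -ᵥ T.points j) - s • (T.points k -ᵥ T.points j) := by
    rw [AffineMap.lineMap_apply, vsub_vadd_eq_vsub_sub]
  have e2 : T.points i -ᵥ T.points k =
      (T.points i -ᵥ T.points j) - (T.points k -ᵥ T.points j) := by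
    rw [vsub_sub_vsub_cancel_right]
  rw [dist_comm (T.points j), dist_eq_norm_vsub V (T.points i) (T.points j),
    dist_eq_norm_vsub V (T.points k), dist_eq_norm_vsub V (T.points i) (T.points k), e2]
  rw [e1] at h1 h2
  rw [e2] at h2
  set u := T.points i -ᵥ T.points j
  set w := T.points k -ᵥ T.points j
  rw [inner_sub_right, inner_smul_right, real_inner_self_eq_norm_sq] at h1
  rw [inner_sub_left, inner_sub_right, inner_sub_right, inner_smul_right, inner_smul_right,
    real_inner_self_eq_norm_sq, real_inner_self_eq_norm_sq, real_inner_comm u w] at h2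
  rw [norm_sub_sq_real]
  linear_combination (-‖w‖ ^ 2 + ⟪u, w⟫) * h1 - ⟪u, w⟫ * h2

/-- The square of abc = 4R · area, from the laws of sines and cosines at the vertex j. -/
theorem sq_dist_mul_dist_mul_dist (T : Triangle ℝ P) {i j k : Fin 3} (hij : i ≠ j) (hik : i ≠ k)
    (hjk : j ≠ k) :
    (dist (T.points i) (T.points j) * dist (T.points j) (T.points k) *
      dist (T.points i) (T.points k)) ^ 2 =
      4 * T.circumradius ^ 2 *
        (dist (T.points i) (T.points j) ^ 2 * dist (T.points j) (T.points k) ^ 2 -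
          ((dist (T.points i) (T.points j) ^ 2 + dist (T.points j) (T.points k) ^ 2 -
            dist (T.points i) (T.points k) ^ 2) / 2) ^ 2) := by
  have hsin := T.dist_div_sin_angle_eq_two_mul_circumradius hij hik hjk
  have hcos := law_cos (T.points i) (T.points j) (T.points k)
  have hsc := Real.sin_sq_add_cos_sq (∠ (T.points i) (T.points j) (T.points k))
  have hR := T.circumradius_pos
  have hne : Real.sin (∠ (T.points i) (T.points j) (T.points k)) ≠ 0 := by
    intro h
    rw [h, div_zero] at hsin
    linarith
  rw [div_eq_iff hne] at hsin
  rw [dist_comm (T.points k) (T.points j)] at hcos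
  set s := Real.sin (∠ (T.points i) (T.points j) (T.points k))
  set c := Real.cos (∠ (T.points i) (T.points j) (T.points k))
  set x := dist (T.points i) (T.points j)
  set y := dist (T.points j) (T.points k)
  have h : (x ^ 2 + y ^ 2 - dist (T.points i) (T.points k) ^ 2) / 2 = x * y * c := by
    linear_combination (-1 / 2) * hcos
  rw [h, hsin]
  linear_combination 4 * T.circumradius ^ 2 * x ^ 2 * y ^ 2 * hsc

/-- The tangent lengths `x, y, z` of a triangle, and the inradius and circumradius in terms of
them. -/
theorem exists_tangent_lengths (T : Triangle ℝ P) :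
    ∃ x y z : ℝ, 0 < x ∧ 0 < y ∧ 0 < z ∧ dist (T.points 0) (T.points 1) = x + y ∧
      dist (T.points 1) (T.points 2) = y + z ∧ dist (T.points 2) (T.points 0) = z + x ∧
      T.inradius ^ 2 * (x + y + z) = x * y * z ∧
      2 * T.inradius / T.circumradius * ((x + y) * (y + z) * (z + x)) = 8 * (x * y * z) := by
  have h0 := T.height_sq_mul_dist_sq (i := 0) (j := 1) (k := 2) (by decide) (by decide) (by decide)
  have h1 := T.height_sq_mul_dist_sq (i := 1) (j := 2) (k := 0) (by decide) (by decide) (by decide)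
  have h2 := T.height_sq_mul_dist_sq (i := 2) (j := 0) (k := 1) (by decide) (by decide) (by decide)
  have hR := T.sq_dist_mul_dist_mul_dist (i := 0) (j := 1) (k := 2) (by decide) (by decide)
    (by decide)
  have hr : T.inradius = (∑ i, (T.height i)⁻¹)⁻¹ := by
    rw [T.inradius_eq_abs_inv_sum, abs_of_pos]
    · simp
    · exact inv_pos.2 (Finset.sum_pos (fun i _ ↦ by simp) ⟨0, Finset.mem_univ _⟩)
  rw [Fin.sum_univ_three] at hr
  have p0 := T.height_pos 0
  have p1 := T.height_pos 1
  have p2 := T.height_pos 2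
  have hRpos := T.circumradius_pos
  have hinj := T.independent.injective
  have d0 : 0 < dist (T.points 0) (T.points 1) := dist_pos.2 (hinj.ne (by decide))
  have d1 : 0 < dist (T.points 1) (T.points 2) := dist_pos.2 (hinj.ne (by decide))
  have d2 : 0 < dist (T.points 2) (T.points 0) := dist_pos.2 (hinj.ne (by decide))
  have t0 := dist_triangle (T.points 0) (T.points 1) (T.points 2)
  have t1 := dist_triangle (T.points 1) (T.points 2) (T.points 0)
  have t2 := dist_triangle (T.points 2) (T.points 0) (T.points 1)
  rw [dist_comm (T.points 0) (T.points 2)] at h0 hR t0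
  rw [dist_comm (T.points 1) (T.points 0)] at h1 t1
  rw [dist_comm (T.points 2) (T.points 1)] at h2 t2
  set c := dist (T.points 0) (T.points 1)
  set a := dist (T.points 1) (T.points 2)
  set b := dist (T.points 2) (T.points 0)
  obtain ⟨x, hx⟩ : ∃ x, x = (c + b - a) / 2 := ⟨_, rfl⟩
  obtain ⟨y, hy⟩ : ∃ y, y = (c + a - b) / 2 := ⟨_, rfl⟩
  obtain ⟨z, hz⟩ : ∃ z, z = (a + b - c) / 2 := ⟨_, rfl⟩
  have hc : c = x + y := by linarith
  have ha : a = y + z := by linarith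
  have hb : b = z + x := by linarith
  clear_value a b c
  subst hc ha hb
  have x0 : 0 ≤ x := by linarith
  have y0 : 0 ≤ y := by linarith
  have z0 : 0 ≤ z := by linarith
  have k0 : (T.height 0 * (y + z)) ^ 2 = 4 * (x + y + z) * (x * y * z) := by
    linear_combination h0
  have k1 : (T.height 1 * (z + x)) ^ 2 = 4 * (x + y + z) * (x * y * z) := by
    linear_combination h1
  have k2 : (T.height 2 * (x + y)) ^ 2 = 4 * (x + y + z) * (x * y * z) := by
    linear_combination h2
  -- The triangle inequalities gave only nonnegative tangent lengths; positive height, hence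
  -- positive area, makes them strict.
  have hK : 0 < 4 * (x + y + z) * (x * y * z) := by rw [← k0]; positivity
  have x1 : 0 < x := x0.lt_of_ne (by rintro rfl; simp at hK)
  have y1 : 0 < y := y0.lt_of_ne (by rintro rfl; simp at hK)
  have z1 : 0 < z := z0.lt_of_ne (by rintro rfl; simp at hK)
  have e1 : T.height 1 * (z + x) = T.height 0 * (y + z) :=
    (pow_left_inj₀ (by positivity) (by positivity) two_ne_zero).1 (k1.trans k0.symm)
  have e2 : T.height 2 * (x + y) = T.height 0 * (y + z) :=
    (pow_left_inj₀ (by positivity) (by positivity) two_ne_zero).1 (k2.trans k0.symm)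
  have hr2 : 2 * (x + y + z) * T.inradius = T.height 0 * (y + z) := by
    rw [hr, eq_div_of_mul_eq (by positivity) e1, eq_div_of_mul_eq (by positivity) e2]
    field_simp
    ring
  have hR2 : (x + y) * (y + z) * (z + x) = 2 * T.circumradius * (T.height 0 * (y + z)) := by
    refine (pow_left_inj₀ (by positivity) (by positivity) two_ne_zero).1 ?_
    rw [hR, mul_pow _ (T.height 0 * (y + z)), k0]
    ring
  have hr3 : T.inradius ^ 2 * (x + y + z) = x * y * z := by
    have hp : 4 * (x + y + z) ≠ 0 := by positivity
    refine mul_left_cancel₀ hp ?_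
    rw [← k0, ← hr2]
    ring
  refine ⟨x, y, z, x1, y1, z1, rfl, rfl, rfl, hr3, ?_⟩
  rw [hR2, ← hr2, ← hr3]
  field_simp
  ring

end Affine.Triangle

/-! ### Comparison with isosceles triangles -/

/-- The key identity comparing tangent lengths `x, y, z` with those of an isosceles triangle having
the same ratio `2 * r / R`. -/
theorem isosceles_comparison {x y z t : ℝ}
    (h : t * (1 - t) * ((x + y) * (y + z) * (z + x)) = 2 * (x * y * z)) :
    (t ^ 2 * (1 - t) * (x + y + z) ^ 3 - (1 + t) ^ 3 * (x * y * z)) *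
      ((t * (1 - t) + 2) * x - t * (1 - t) * (x + y + z)) =
    t * (1 - t) * (x + y + z) * (((1 + t) * x - t * (x + y + z)) ^ 2 *
      ((1 + t) * x - (1 - t) * (x + y + z))) := by
  -- With P = x + y + z the hypothesis is linear in yz: yz ((t(1-t) + 2)x - t(1-t)P) = t(1-t) P x (P
  -- - x). Eliminating yz leaves a cubic in x with double root tP/(1+t) and simple root
  -- (1-t)P/(1+t).
  linear_combination (1 + t) ^ 3 * x * h

/-- Choosing x as the largest tangent length, together with t ≥ 1/2, fixes the signs of the two
linear factors in `isosceles_comparison`. -/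
theorem isosceles_comparison_nonneg {x y z t : ℝ} (hx : 0 < x) (hy : 0 < y) (hz : 0 < z)
    (hyx : y ≤ x) (hzx : z ≤ x) (ht : 1 / 2 ≤ t) (ht1 : t < 1)
    (h : t * (1 - t) * ((x + y) * (y + z) * (z + x)) = 2 * (x * y * z)) :
    (1 + t) ^ 3 * (x * y * z) ≤ t ^ 2 * (1 - t) * (x + y + z) ^ 3 ∧
      ((1 + t) ^ 3 * (x * y * z) = t ^ 2 * (1 - t) * (x + y + z) ^ 3 →
        x + y = 2 * t * (y + z) ∧ z + x = y + z ∨ z + x = 2 * t * (y + z) ∧ x + y = y + z) := by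
  have h1 : 0 < 1 - t := by linarith
  have h0 : 0 < t := by linarith
  have hτ : 0 < t * (1 - t) := mul_pos h0 h1
  have hp : 0 < x + y + z := by positivity
  have key := isosceles_comparison h
  have hf : 0 < (t * (1 - t) + 2) * x - t * (1 - t) * (x + y + z) := by nlinarith
  have hg : 0 ≤ (1 + t) * x - (1 - t) * (x + y + z) := by nlinarith
  refine ⟨?_, fun heq ↦ ?_⟩
  · rw [← sub_nonneg]
    refine nonneg_of_mul_nonneg_left ?_ hf
    rw [key]
    positivity
  · rw [heq, sub_self, zero_mul] at key
    have hx' : (1 + t) * x - t * (x + y + z) = 0 := by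
      rcases mul_eq_zero.1 key.symm with h2 | h2
      · exact absurd h2 (by positivity)
      rcases mul_eq_zero.1 h2 with h3 | h3
      · exact pow_eq_zero_iff two_ne_zero |>.1 h3
      -- For x largest the simple root forces t = 1/2, where it coincides with the double root.
      · nlinarith
    have hxs : x = t * (y + z) := by linear_combination hx'
    -- Once x = t(y + z), the constraint is a quadratic in y; its two roots are the two placements
    -- of the base.
    have hyz : (y - t * (y + z)) * (y - (1 - t) * (y + z)) = 0 := by
      have h2 : (1 + t) * t * (y + z) ≠ 0 := by positivity
      refine mul_left_cancel₀ h2 ?_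
      rw [hxs] at h
      linear_combination h
    rcases mul_eq_zero.1 hyz with h2 | h2
    · left
      constructor <;> linarith
    · right
      constructor <;> linarith

/-- Exchanging the two equal sides changes nothing, so the six labellings collapse to the three
cyclic ones. -/
theorem sideRatio_iff {s : ℝ} {T : Affine.Triangle ℝ (EuclideanSpace ℝ (Fin 2))} :
    SideRatio s T ↔
      (dist (T.points 1) (T.points 2) = s * dist (T.points 0) (T.points 1) ∧
        dist (T.points 2) (T.points 0) = dist (T.points 0) (T.points 1)) ∨
      (dist (T.points 2) (T.points 0) = s * dist (T.points 1) (T.points 2) ∧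
        dist (T.points 0) (T.points 1) = dist (T.points 1) (T.points 2)) ∨
      (dist (T.points 0) (T.points 1) = s * dist (T.points 2) (T.points 0) ∧
        dist (T.points 1) (T.points 2) = dist (T.points 2) (T.points 0)) := by
  constructor
  · rintro ⟨σ, h1, h2⟩
    have h01 : σ 0 ≠ σ 1 := by simp
    have h02 : σ 0 ≠ σ 2 := by simp
    have h12 : σ 1 ≠ σ 2 := by simp
    have c1 := dist_comm (T.points 1) (T.points 0)
    have c2 := dist_comm (T.points 2) (T.points 1)
    have c3 := dist_comm (T.points 0) (T.points 2)
    generalize σ 0 = i at *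
    generalize σ 1 = j at *
    generalize σ 2 = k at *
    fin_cases i <;> fin_cases j <;> fin_cases k <;> simp_all
  · rintro (h | h | h)
    · exact ⟨1, h⟩
    · exact ⟨Equiv.addRight 1, h⟩
    · exact ⟨Equiv.addRight 2, h⟩

section TangentLengths

variable {x y z r q t : ℝ}

/-- A triangle with tangent lengths `x, y, z` and side ratio `2 * t : 1 : 1`. -/
theorem isosceles_ratio (hx : 0 < x) (hy : 0 < y) (hz : 0 < z) (ht : 0 < t) (hr : 0 < r)
    (hr2 : r ^ 2 * (x + y + z) = x * y * z)
    (hq : q * ((x + y) * (y + z) * (z + x)) = 8 * (x * y * z))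
    (h1 : y + z = 2 * t * (x + y)) (h2 : z + x = x + y) :
    t < 1 ∧ q = 4 * t * (1 - t) ∧ x + y + z = isoscelesRatio t * r := by
  obtain rfl : z = y := by linarith
  obtain ⟨s, hs⟩ : ∃ s, s = x + z := ⟨_, rfl⟩
  have hz' : z = t * s := by rw [hs]; linarith
  have hx' : x = (1 - t) * s := by linear_combination -hz' - hs
  have hs0 : 0 < s := by linarith
  have ht1 : 0 < 1 - t := by
    rw [hx'] at hx
    exact pos_of_mul_pos_left hx hs0.le
  rw [hx', hz'] at hq hr2
  refine ⟨by linarith, ?_, ?_⟩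
  · have : 2 * t * s ^ 3 ≠ 0 := by positivity
    refine mul_left_cancel₀ this ?_
    linear_combination hq
  · have hG := isoscelesRatio_pos ht (by linarith)
    have hG2 := isoscelesRatio_sq ht (by linarith)
    rw [hx', hz']
    refine (pow_left_inj₀ (by nlinarith) (by positivity) two_ne_zero).1 ?_
    have : t ^ 2 * (1 - t) * s ≠ 0 := by positivity
    refine mul_left_cancel₀ this ?_
    linear_combination - (r ^ 2 * s) * hG2 - (1 + t) ^ 2 * hr2

/-- Squaring and using r²(x + y + z) = xyz turns the comparison of p with `isoscelesRatio t * r`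
into a polynomial one free of r. -/
theorem isoscelesRatio_mul_le (hx : 0 < x) (hy : 0 < y) (hz : 0 < z) (hr : 0 < r) (ht : 0 < t)
    (ht1 : t < 1) (hr2 : r ^ 2 * (x + y + z) = x * y * z) :
    (isoscelesRatio t * r ≤ x + y + z ↔
      (1 + t) ^ 3 * (x * y * z) ≤ t ^ 2 * (1 - t) * (x + y + z) ^ 3) ∧
    (x + y + z = isoscelesRatio t * r ↔
      (1 + t) ^ 3 * (x * y * z) = t ^ 2 * (1 - t) * (x + y + z) ^ 3) := by
  have hG := isoscelesRatio_pos ht ht1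
  have hG2 := isoscelesRatio_sq ht ht1
  have h1 : 0 < 1 - t := by linarith
  have hp : 0 < x + y + z := by positivity
  have hc : 0 < t ^ 2 * (1 - t) * (x + y + z) := by positivity
  have e : (1 + t) ^ 3 * (x * y * z) =
      t ^ 2 * (1 - t) * (x + y + z) * (isoscelesRatio t * r) ^ 2 := by
    linear_combination -(r ^ 2 * (x + y + z)) * hG2 - (1 + t) ^ 3 * hr2
  rw [e, show t ^ 2 * (1 - t) * (x + y + z) ^ 3 =
    t ^ 2 * (1 - t) * (x + y + z) * (x + y + z) ^ 2 by ring]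
  constructor
  · rw [mul_le_mul_iff_right₀ hc, pow_le_pow_iff_left₀ (by positivity) hp.le two_ne_zero]
  · rw [mul_right_inj' hc.ne', pow_left_inj₀ (by positivity) hp.le two_ne_zero, eq_comm]

end TangentLengths

/-! ### Minimizing p/r at fixed 2r/R, and realizing isosceles shapes. -/

namespace Affine.Triangle

variable (T : Affine.Triangle ℝ (EuclideanSpace ℝ (Fin 2)))

theorem of_sideRatio {t : ℝ} (ht : 0 < t) (h : SideRatio (2 * t) T) :
    t < 1 ∧ 2 * T.inradius / T.circumradius = 4 * t * (1 - t) ∧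
      semiperimeter T = isoscelesRatio t * T.inradius := by
  obtain ⟨x, y, z, hx, hy, hz, h01, h12, h20, hr2, hq⟩ := T.exists_tangent_lengths
  have hr := T.inradius_pos
  have hp : semiperimeter T = x + y + z := by rw [semiperimeter, h01, h12, h20]; ring
  rw [sideRatio_iff, h01, h12, h20] at h
  rw [hp]
  rcases h with h | h | h
  · exact isosceles_ratio hx hy hz ht hr hr2 hq h.1 h.2
  · rw [show x + y + z = y + z + x by ring]
    exact isosceles_ratio hy hz hx ht hr (by linarith) (by linarith) h.1 h.2
  · rw [show x + y + z = z + x + y by ring]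
    exact isosceles_ratio hz hx hy ht hr (by linarith) (by linarith) h.1 h.2

/-- The isosceles triangle with the same ratio `2 * r / R` and apex angle at least `π / 3`
minimizes `p / r`. -/
theorem exists_isosceles_le :
    ∃ t ∈ Set.Ico (1 / 2 : ℝ) 1, 2 * T.inradius / T.circumradius = 4 * t * (1 - t) ∧
      isoscelesRatio t * T.inradius ≤ semiperimeter T ∧
      (semiperimeter T = isoscelesRatio t * T.inradius → SideRatio (2 * t) T) := by
  obtain ⟨x, y, z, hx, hy, hz, h01, h12, h20, hr2, hq⟩ := T.exists_tangent_lengths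
  have hr := T.inradius_pos
  have hR := T.circumradius_pos
  have hp : semiperimeter T = x + y + z := by rw [semiperimeter, h01, h12, h20]; ring
  have hq0 : 0 < 2 * T.inradius / T.circumradius := by positivity
  simp_rw [hp, sideRatio_iff, h01, h12, h20]
  set q := 2 * T.inradius / T.circumradius
  clear_value q
  -- Euler's inequality, in the form 8xyz ≤ (x + y)(y + z)(z + x).
  have hq1 : q ≤ 1 := by
    have h1 : 0 < (x + y) * (y + z) * (z + x) := by positivity
    refine le_of_mul_le_mul_right ?_ h1
    rw [hq]
    nlinarith [mul_nonneg hx.le (sq_nonneg (y - z)), mul_nonneg hy.le (sq_nonneg (z - x)),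
      mul_nonneg hz.le (sq_nonneg (x - y))]
  have hs := Real.sq_sqrt (sub_nonneg.2 hq1)
  have hs0 := Real.sqrt_nonneg (1 - q)
  have hs1 : √(1 - q) < 1 := (Real.sqrt_lt' one_pos).2 (by linarith)
  -- The larger root of 4t(1 - t) = q, since the comparison needs t ≥ 1/2.
  obtain ⟨t, ht⟩ : ∃ t, t = (1 + √(1 - q)) / 2 := ⟨_, rfl⟩
  have ht0 : 1 / 2 ≤ t := by linarith
  have ht1 : t < 1 := by linarith
  have hqt : q = 4 * t * (1 - t) := by rw [ht]; linear_combination hs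
  refine ⟨t, ⟨ht0, ht1⟩, hqt, ?_⟩
  obtain ⟨e1, e2⟩ := isoscelesRatio_mul_le hx hy hz hr (by linarith) ht1 hr2
  rw [e1, e2]
  rw [hqt] at hq
  -- The largest tangent length is singled out, and the comparison is applied after a cyclic
  -- relabelling.
  rcases le_total y x with hyx | hxy
  · rcases le_total z x with hzx | hxz
    · obtain ⟨i1, i2⟩ := isosceles_comparison_nonneg hx hy hz hyx hzx ht0 ht1 (by linarith)
      refine ⟨i1, fun h ↦ ?_⟩
      rcases i2 h with ⟨j1, j2⟩ | ⟨j1, j2⟩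
      · exact Or.inr (Or.inr ⟨by rw [j1, j2], j2.symm⟩)
      · exact Or.inr (Or.inl ⟨j1, j2⟩)
    · obtain ⟨i1, i2⟩ := isosceles_comparison_nonneg hz hx hy hxz (hyx.trans hxz) ht0 ht1
        (by linarith)
      refine ⟨by convert i1 using 2 <;> ring, fun h ↦ ?_⟩
      rcases i2 (by convert h using 2 <;> ring) with ⟨j1, j2⟩ | ⟨j1, j2⟩
      · exact Or.inr (Or.inl ⟨by rw [j1, j2], j2.symm⟩)
      · exact Or.inl ⟨j1, j2⟩
  · rcases le_total z y with hzy | hyz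
    · obtain ⟨i1, i2⟩ := isosceles_comparison_nonneg hy hz hx hzy hxy ht0 ht1 (by linarith)
      refine ⟨by convert i1 using 2 <;> ring, fun h ↦ ?_⟩
      rcases i2 (by convert h using 2 <;> ring) with ⟨j1, j2⟩ | ⟨j1, j2⟩
      · exact Or.inl ⟨by rw [j1, j2], j2.symm⟩
      · exact Or.inr (Or.inr ⟨j1, j2⟩)
    · obtain ⟨i1, i2⟩ := isosceles_comparison_nonneg hz hx hy (hxy.trans hyz) hyz ht0 ht1
        (by linarith)
      refine ⟨by convert i1 using 2 <;> ring, fun h ↦ ?_⟩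
      rcases i2 (by convert h using 2 <;> ring) with ⟨j1, j2⟩ | ⟨j1, j2⟩
      · exact Or.inr (Or.inl ⟨by rw [j1, j2], j2.symm⟩)
      · exact Or.inl ⟨j1, j2⟩

theorem exists_sideRatio {t : ℝ} (ht : 0 < t) (ht1 : t < 1) :
    ∃ T : Affine.Triangle ℝ (EuclideanSpace ℝ (Fin 2)), SideRatio (2 * t) T := by
  have h := one_sub_sq_pos ht ht1
  have hs := Real.sqrt_pos.2 h
  have hsq := Real.sq_sqrt h.le
  set s := √(1 - t ^ 2)
  have hind : AffineIndependent ℝ ![!₂[0, s], !₂[-t, 0], !₂[t, 0]] := by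
    rw [affineIndependent_iff_not_collinear_set, collinear_iff_of_mem (p₀ := !₂[0, s]) (by simp)]
    rintro ⟨v, hv⟩
    obtain ⟨a, ha⟩ := hv !₂[-t, 0] (by simp)
    obtain ⟨b, hb⟩ := hv !₂[t, 0] (by simp)
    have a0 := congrArg (fun w : EuclideanSpace ℝ (Fin 2) ↦ w 0) ha
    have a1 := congrArg (fun w : EuclideanSpace ℝ (Fin 2) ↦ w 1) ha
    have b0 := congrArg (fun w : EuclideanSpace ℝ (Fin 2) ↦ w 0) hb
    have b1 := congrArg (fun w : EuclideanSpace ℝ (Fin 2) ↦ w 1) hb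
    simp at a0 a1 b0 b1
    have hv1 : v 1 ≠ 0 := by
      intro h0
      rw [h0] at a1
      linarith
    have hab : a = b := by
      refine mul_right_cancel₀ hv1 ?_
      linarith
    rw [hab] at a0
    linarith
  refine ⟨⟨_, hind⟩, 1, ?_⟩
  have d1 : dist (!₂[-t, 0] : EuclideanSpace ℝ (Fin 2)) !₂[t, 0] = 2 * t := by
    rw [EuclideanSpace.dist_eq, Real.sqrt_eq_iff_mul_self_eq (by positivity) (by positivity)]
    simp [Real.dist_eq]
    ring
  have d2 : dist (!₂[0, s] : EuclideanSpace ℝ (Fin 2)) !₂[-t, 0] = 1 := by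
    rw [EuclideanSpace.dist_eq, Real.sqrt_eq_iff_mul_self_eq (by positivity) (by positivity)]
    simp [Real.dist_eq]
    linarith
  have d3 : dist (!₂[t, 0] : EuclideanSpace ℝ (Fin 2)) !₂[0, s] = 1 := by
    rw [EuclideanSpace.dist_eq, Real.sqrt_eq_iff_mul_self_eq (by positivity) (by positivity)]
    simp [Real.dist_eq]
    linarith
  simp [d1, d2, d3]

end Affine.Triangle

theorem theorem2 :
    ∃ k₀ t₁ : ℝ,
      -- `k₀` is the only root of `p₄` in `(1/2, 9/13)`, and `k₀ = 0.6898369707` to ten decimals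
      (k₀ ∈ Set.Ioo (1 / 2 : ℝ) (9 / 13) ∧ |k₀ - 0.6898369707| < 5 / 10 ^ 11 ∧
        ∀ k ∈ Set.Ioo (1 / 2 : ℝ) (9 / 13), p₄ k = 0 ↔ k = k₀) ∧
      -- `t₁` is the only root of `p₂` in `(1/2, 3/5)`, and `t₁ = 0.5194285605` to ten decimals
      (t₁ ∈ Set.Ioo (1 / 2 : ℝ) (3 / 5) ∧ |t₁ - 0.5194285605| < 5 / 10 ^ 11 ∧
        ∀ t ∈ Set.Ioo (1 / 2 : ℝ) (3 / 5), p₂ t = 0 ↔ t = t₁) ∧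
      -- the inequality holds for all triangles if `k ≤ k₀`
      (∀ k : ℝ, k ≤ k₀ →
        ∀ T : Affine.Triangle ℝ (EuclideanSpace ℝ (Fin 2)), lowerBound k T ≤ semiperimeter T) ∧
      -- and `k₀` is best possible
      (∀ k : ℝ, k₀ < k →
        ∃ T : Affine.Triangle ℝ (EuclideanSpace ℝ (Fin 2)), semiperimeter T < lowerBound k T) ∧
      -- the cases of equality
      (∀ k : ℝ, k ≤ k₀ → ∀ T : Affine.Triangle ℝ (EuclideanSpace ℝ (Fin 2)),
        semiperimeter T = lowerBound k T ↔
          SideRatio 1 T ∨ (k = k₀ ∧ SideRatio (2 * t₁) T)) := by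
  obtain ⟨k₀, t₁, hE⟩ := exists_isExtremal
  have hk := hE.mem
  have ht := hE.gt
  have ht' := hE.lt
  have hk_mem : k₀ ∈ Set.Ioo (1 / 2 : ℝ) (9 / 13) := by
    constructor <;> norm_num <;> linarith [hk.1, hk.2]
  have ht_mem : t₁ ∈ Set.Ioo (1 / 2 : ℝ) (3 / 5) := by
    constructor <;> norm_num <;> linarith
  have hp₄ : p₄ k₀ = 0 := p₄_eq_zero (by linarith) (by linarith) hE.root hE.sq_mul
  have hbound (k t : ℝ) (T : Affine.Triangle ℝ (EuclideanSpace ℝ (Fin 2)))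
      (hq : 2 * T.inradius / T.circumradius = 4 * t * (1 - t)) :
      lowerBound k T = isoscelesRatio t * T.inradius - isoscelesExcess k t * T.inradius := by
    rw [lowerBound, hq, isoscelesExcess]
    ring
  have hpow {t : ℝ} (h1 : 1 / 2 < t) (h2 : t < 1) : 0 < 1 - (4 * t * (1 - t)) ^ 5 :=
    sub_pos.2 (pow_lt_one₀ (by nlinarith) (by nlinarith [sq_pos_of_pos (sub_pos.2 h1)])
      (by norm_num))
  -- The excess is affine in k with slope -(1 - q⁵), negative for t > 1/2. This carries
  -- nonnegativity from k₀ to all smaller k, negative ones included, and makes the excess negative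
  -- at t₁ for k > k₀.
  have hsub (k t : ℝ) : isoscelesExcess k t =
      isoscelesExcess k₀ t + (k₀ - k) * (1 - (4 * t * (1 - t)) ^ 5) := by
    simp only [isoscelesExcess]
    ring
  have hnonneg {k t : ℝ} (hk : k ≤ k₀) (h1 : 1 / 2 ≤ t) (h2 : t < 1) :
      0 ≤ isoscelesExcess k t ∧ (isoscelesExcess k t = 0 → t = 1 / 2 ∨ k = k₀ ∧ t = t₁) := by
    rcases h1.eq_or_lt with rfl | h1
    · exact ⟨(isoscelesExcess_half k).ge, fun _ ↦ Or.inl rfl⟩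
    have h3 : 0 ≤ isoscelesExcess k₀ t := by
      rcases eq_or_ne t t₁ with rfl | hne
      · exact hE.isoscelesExcess_eq_zero.ge
      · exact (hE.isoscelesExcess_pos h1 h2 hne).le
    have h4 := mul_nonneg (sub_nonneg.2 hk) (hpow h1 h2).le
    rw [hsub]
    refine ⟨add_nonneg h3 h4, fun h ↦ Or.inr ⟨?_, ?_⟩⟩
    · have h5 : (k₀ - k) * (1 - (4 * t * (1 - t)) ^ 5) = 0 := by linarith
      rcases mul_eq_zero.1 h5 with h6 | h6
      · linarith
      · exact absurd h6 (hpow h1 h2).ne'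
    · by_contra hne
      linarith [hE.isoscelesExcess_pos h1 h2 hne]
  refine ⟨k₀, t₁, ⟨hk_mem, ?_, fun k hk' ↦ ⟨fun h ↦ p₄_root_unique hk' hk_mem h hp₄, ?_⟩⟩,
    ⟨ht_mem, ?_, fun t ht' ↦ ⟨fun h ↦ p₂_root_unique ht' ht_mem h hE.root, ?_⟩⟩, ?_, ?_, ?_⟩
  · rw [abs_lt]
    constructor <;> norm_num at hk ⊢ <;> linarith [hk.1, hk.2]
  · rintro rfl
    exact hp₄
  · rw [abs_lt]
    constructor <;> norm_num at ht ht' ⊢ <;> linarith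
  · rintro rfl
    exact hE.root
  · intro k hk T
    obtain ⟨t, ⟨h1, h2⟩, hq, hle, -⟩ := T.exists_isosceles_le
    rw [hbound k t T hq]
    have := mul_nonneg (hnonneg hk h1 h2).1 T.inradius_pos.le
    linarith
  · intro k hk
    obtain ⟨T, hT⟩ := Affine.Triangle.exists_sideRatio (t := t₁) (by linarith) (by linarith)
    obtain ⟨h1, hq, hp⟩ := T.of_sideRatio (by linarith) hT
    refine ⟨T, ?_⟩
    rw [hbound k t₁ T hq, hp, hsub, hE.isoscelesExcess_eq_zero]
    have := mul_pos (mul_pos (sub_pos.2 hk) (hpow (by linarith) h1)) T.inradius_pos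
    linarith
  · intro k hk T
    constructor
    · intro h
      obtain ⟨t, ⟨h1, h2⟩, hq, hle, heq⟩ := T.exists_isosceles_le
      rw [hbound k t T hq] at h
      have h3 := hnonneg hk h1 h2
      have h4 := mul_nonneg h3.1 T.inradius_pos.le
      have h5 : isoscelesExcess k t = 0 :=
        (mul_eq_zero.1 (show isoscelesExcess k t * T.inradius = 0 by linarith)).resolve_right
          T.inradius_pos.ne'
      have h6 := heq (by linarith)
      rcases h3.2 h5 with rfl | ⟨rfl, rfl⟩
      · left
        simpa using h6
      · exact Or.inr ⟨rfl, h6⟩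
    · rintro (h | ⟨rfl, h⟩)
      · obtain ⟨-, hq, hp⟩ := T.of_sideRatio (t := 1 / 2) (by norm_num) (by simpa using h)
        rw [hbound k _ T hq, hp, isoscelesExcess_half, zero_mul, sub_zero]
      · obtain ⟨-, hq, hp⟩ := T.of_sideRatio (by linarith) h
        rw [hbound _ _ T hq, hp, hE.isoscelesExcess_eq_zero, zero_mul, sub_zero]
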